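/- Let $X$ be a finite-dimensional (real) Hilbert space. Let $J\in C^1(X,\mathbb R)$ be bounded below on $X$, and let $\mu\in C^1(X,[0,+\infty))$ be coercive, i.e. $\mu(x)\to+\infty$ as $\|x\|\to\infty$, and such that its derivative $\mu':X\to X^*$ admits a continuous inverse $X^*\to X$. Let $\tilde x\in X$ and $r>0$ be such that (B.2) $\displaystyle\inf_{x\in X}J(x)<\inf_{\mu(x)\le r}J(x)$; (B.3) $\mu(\tilde x)<r$ and $\displaystyle J(\tilde x)<\inf_{\mu(x)=r}J(x)$. Then there exists a nonempty open set $A\subseteq(0,+\infty)$ such that for every $\lambda\in A$ the functional $\mu+\lambda J$ has at least three critical points in $X$. -/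

import Mathlib

open Filter

/-- A functional on a normed space is coercive if it tends to `+∞` as `‖u‖ → ∞`. -/
def IsCoerciveFunctional {X : Type*} [NormedAddCommGroup X] (f : X → ℝ) : Prop :=
  Tendsto f (comap (fun u : X => ‖u‖) atTop) atTop

/-- `x` is a critical point of `f`: `f` is Fréchet differentiable at `x` with derivative zero. -/
def IsCritPt {X : Type*} [NormedAddCommGroup X] [NormedSpace ℝ X] (f : X → ℝ) (x : X) : Prop :=
  HasFDerivAt f (0 : X →L[ℝ] ℝ) x

/-- The derivative `f' : X → X*` admits a continuous inverse `X* → X`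
(`X*` being the topological dual with its norm topology). -/
def DerivAdmitsContinuousInverse {X : Type*} [NormedAddCommGroup X] [NormedSpace ℝ X]
    (f : X → ℝ) : Prop :=
  ∃ g : (X →L[ℝ] ℝ) → X, Continuous g ∧
    Function.LeftInverse g (fderiv ℝ f) ∧ Function.RightInverse g (fderiv ℝ f)

open scoped Topology

/-! Put `f = μ + l * J`. On the sphere-like set `μ = r` it is at least `r + l * β`, a barrier lying
above `f x₀`. Hence a minimizer of `f` over `μ ≤ r` stays off the boundary and is a local minimum.
For large `l` the global minimizer escapes to `μ > r`. Any connected set joining the two crosses `μ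
= r`, so a mountain pass yields a third critical point at or above the barrier. The mountain pass
needs no deformation flow: one short explicit gradient step, then compactness from coercivity,
suffices. -/

/-- Sequences along which a coercive functional on a finite-dimensional space stays bounded above
have convergent subsequences. -/
lemma IsCoerciveFunctional.exists_tendsto_subseq {X : Type*} [NormedAddCommGroup X]
    [NormedSpace ℝ X] [FiniteDimensional ℝ X] {f : X → ℝ} (hf : IsCoerciveFunctional f)
    {M : ℝ} {u : ℕ → X} (hu : ∀ n, f (u n) ≤ M) :
    ∃ x, ∃ φ : ℕ → ℕ, StrictMono φ ∧ Tendsto (u ∘ φ) atTop (𝓝 x) := by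
  have := FiniteDimensional.proper ℝ X
  have h := hf.eventually (eventually_gt_atTop M)
  rw [eventually_comap] at h
  obtain ⟨R, hR⟩ := eventually_atTop.1 h
  obtain ⟨x, -, φ, hφ, hx⟩ := (isCompact_closedBall (0 : X) R).tendsto_subseq (x := u) fun n => by
    rw [mem_closedBall_zero_iff]
    by_contra! hlt
    exact absurd (hu n) (not_le.2 (hR _ hlt.le _ rfl))
  exact ⟨x, φ, hφ, hx⟩

/-- A continuous coercive functional on a finite-dimensional space attains its minimum on every
nonempty closed set. -/
lemma IsCoerciveFunctional.exists_isMinOn {X : Type*} [NormedAddCommGroup X]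
    [NormedSpace ℝ X] [FiniteDimensional ℝ X] {f : X → ℝ} (hf : IsCoerciveFunctional f)
    (hc : Continuous f) {s : Set X} (hs : IsClosed s) (hne : s.Nonempty) :
    ∃ x ∈ s, IsMinOn f s x := by
  have := FiniteDimensional.proper ℝ X
  obtain ⟨x₀, hx₀⟩ := hne
  refine hc.continuousOn.exists_isMinOn' hs hx₀ ?_
  have h : Tendsto f (cocompact X) atTop := by
    refine hf.mono_left ?_
    rw [← tendsto_iff_comap]
    exact tendsto_norm_cocompact_atTop
  exact (h.eventually (eventually_ge_atTop (f x₀))).filter_mono inf_le_left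

/-- The sum of a coercive functional and a functional bounded below is coercive. -/
lemma IsCoerciveFunctional.add_bddBelow {X : Type*} [NormedAddCommGroup X] {f g : X → ℝ}
    (hf : IsCoerciveFunctional f) {b : ℝ} (hg : ∀ x, b ≤ g x) :
    IsCoerciveFunctional (fun x => f x + g x) :=
  tendsto_atTop_add_right_of_le _ b hf hg

/-- A point where a differentiable functional has a local minimum is critical. -/
lemma IsLocalMin.isCritPt {X : Type*} [NormedAddCommGroup X] [NormedSpace ℝ X] {f : X → ℝ} {x : X}
    (h : IsLocalMin f x) (hf : DifferentiableAt ℝ f x) : IsCritPt f x := by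
  have := hf.hasFDerivAt
  rwa [h.fderiv_eq_zero] at this

/-- Mountain pass theorem for coercive `C¹` functionals in finite dimension: if every connected set
joining two critical points reaches the level `m`, then there is a critical point of level at
least `m`. -/
theorem exists_isCritPt_ge_of_forall_isPreconnected {X : Type*} [NormedAddCommGroup X]
    [InnerProductSpace ℝ X] [FiniteDimensional ℝ X] {f : X → ℝ} (hf : ContDiff ℝ 1 f)
    (hcoer : IsCoerciveFunctional f) {a b : X} (ha : IsCritPt f a) (hb : IsCritPt f b) {m : ℝ}
    (hm : ∀ C : Set X, IsPreconnected C → a ∈ C → b ∈ C → ∃ x ∈ C, m ≤ f x) :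
    ∃ x, IsCritPt f x ∧ m ≤ f x := by
  have := FiniteDimensional.complete ℝ X
  have hd : Differentiable ℝ f := hf.differentiable one_ne_zero
  have hf' : Continuous (fderiv ℝ f) := hf.continuous_fderiv one_ne_zero
  set G : X → X := fun x => (InnerProductSpace.toDual ℝ X).symm (fderiv ℝ f x) with hG
  have hGc : Continuous G := (InnerProductSpace.toDual ℝ X).symm.continuous.comp hf'
  have hGa : G a = 0 := by simp [hG, ha.fderiv]
  have hGb : G b = 0 := by simp [hG, hb.fderiv]
  -- the minimax level over connected sets joining `a` and `b`
  set T : Set ℝ := {t | ∃ C : Set X, IsPreconnected C ∧ a ∈ C ∧ b ∈ C ∧ ∀ x ∈ C, f x ≤ t} with hT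
  have hTb : ∀ t ∈ T, m ≤ t := by
    rintro t ⟨C, hC, haC, hbC, hCt⟩
    obtain ⟨x, hx, hmx⟩ := hm C hC haC hbC
    exact hmx.trans (hCt x hx)
  have hTne : T.Nonempty := by
    have hcomp : IsCompact (segment ℝ a b) := by
      rw [segment_eq_image]
      exact isCompact_Icc.image (by fun_prop)
    obtain ⟨t, ht⟩ := (hcomp.image hf.continuous).bddAbove
    exact ⟨t, segment ℝ a b, (convex_segment a b).isPreconnected, left_mem_segment ℝ a b,
      right_mem_segment ℝ a b, fun x hx => ht ⟨x, hx, rfl⟩⟩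
  have hTbdd : BddBelow T := ⟨m, hTb⟩
  set c := sInf T with hc
  have hmc : m ≤ c := le_csInf hTne hTb
  set s : ℕ → ℝ := fun n => 1 / ((n : ℝ) + 1) with hs
  have hs0 : ∀ n, 0 < s n := fun n => Nat.one_div_pos_of_nat
  have hs1 : ∀ n, s n ≤ 1 := fun n => by
    rw [hs]
    exact (div_le_one (by positivity)).2 (by linarith [n.cast_nonneg (α := ℝ)])
  have hslim : Tendsto s atTop (𝓝 0) := tendsto_one_div_add_atTop_nhds_zero_nat
  -- pushing an almost optimal connected set along the gradient cannot lower the level much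
  have key : ∀ n, ∃ x, f x ≤ c + s n ^ 2 ∧ c - s n ^ 2 < f (x - s n • G x) := by
    intro n
    obtain ⟨t, ⟨C, hC, haC, hbC, hCt⟩, htlt⟩ :=
      exists_lt_of_csInf_lt hTne (show sInf T < c + s n ^ 2 by have := hs0 n; nlinarith)
    by_contra! hcon
    have hmem : c - s n ^ 2 ∈ T := by
      -- The gradient step fixes `a` and `b`, since `G` vanishes at critical points, so the image of
      -- `C` is still admissible.
      refine ⟨(fun x => x - s n • G x) '' C, hC.image _ (by fun_prop), ⟨a, haC, by simp [hGa]⟩,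
        ⟨b, hbC, by simp [hGb]⟩, ?_⟩
      rintro _ ⟨x, hx, rfl⟩
      exact hcon x ((hCt x hx).trans htlt.le)
    have := csInf_le hTbdd hmem
    have := hs0 n
    nlinarith
  choose u hu1 hu2 using key
  have mvt : ∀ n, ∃ θ ∈ Set.Ioo (0 : ℝ) 1,
      f (u n - s n • G (u n)) - f (u n)
        = -(s n) * fderiv ℝ f (u n - (θ * s n) • G (u n)) (G (u n)) := by
    intro n
    have hder : ∀ θ : ℝ, HasDerivAt (fun θ : ℝ => f (u n - (θ * s n) • G (u n)))
        (fderiv ℝ f (u n - (θ * s n) • G (u n)) (-(s n • G (u n)))) θ := by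
      intro θ
      refine (hd _).hasFDerivAt.comp_hasDerivAt θ ?_
      have h1 : HasDerivAt (fun θ : ℝ => θ * s n) (s n) θ := by
        simpa using (hasDerivAt_id θ).mul_const (s n)
      exact (h1.smul_const (G (u n))).const_sub (u n)
    obtain ⟨θ, hθ, h⟩ := exists_hasDerivAt_eq_slope _ _ one_pos
      (fun θ _ => (hder θ).continuousAt.continuousWithinAt) (fun θ _ => hder θ)
    refine ⟨θ, hθ, ?_⟩
    simp only [map_neg, map_smul, smul_eq_mul, one_mul, zero_mul, zero_smul, sub_zero,
      div_one] at h
    linarith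
  choose θ hθ hmv using mvt
  -- The step lowers `f` by less than `2 * s n ^ 2`, and this drop is `s n` times the derivative.
  -- The tolerance is quadratic in the step length so that the quotient tends to zero.
  have hle : ∀ n, fderiv ℝ f (u n - (θ n * s n) • G (u n)) (G (u n)) ≤ 2 * s n := by
    intro n
    have h1 := hu1 n
    have h2 := hu2 n
    have h3 := hmv n
    have h4 := hs0 n
    by_contra! hlt
    nlinarith [mul_lt_mul_of_pos_left hlt h4]
  obtain ⟨x, φ, hφ, hx⟩ := hcoer.exists_tendsto_subseq (M := c + 1) (u := u) fun n => by
    have := hu1 n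
    have := hs0 n
    have := hs1 n
    nlinarith
  have hsφ : Tendsto (fun n => s (φ n)) atTop (𝓝 0) := hslim.comp hφ.tendsto_atTop
  have hθφ : Tendsto (fun n => θ (φ n) * s (φ n)) atTop (𝓝 0) :=
    squeeze_zero (fun n => mul_nonneg (hθ _).1.le (hs0 _).le)
      (fun n => mul_le_of_le_one_left (hs0 _).le (hθ _).2.le) hsφ
  have hGφ : Tendsto (fun n => G (u (φ n))) atTop (𝓝 (G x)) := (hGc.tendsto x).comp hx
  have hη : Tendsto (fun n => u (φ n) - s (φ n) • G (u (φ n))) atTop (𝓝 x) := by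
    simpa using Tendsto.sub hx (hsφ.smul hGφ)
  have hζ : Tendsto (fun n => u (φ n) - (θ (φ n) * s (φ n)) • G (u (φ n))) atTop (𝓝 x) := by
    simpa using Tendsto.sub hx (hθφ.smul hGφ)
  have hcx : c ≤ f x := by
    refine le_of_tendsto_of_tendsto (f := fun n => c - s (φ n) ^ 2) ?_
      ((hf.continuous.tendsto x).comp hη) (Eventually.of_forall fun n => (hu2 (φ n)).le)
    simpa using (hsφ.pow 2).const_sub c
  have hlim : Tendsto (fun n => fderiv ℝ f (u (φ n) - (θ (φ n) * s (φ n)) • G (u (φ n)))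
      (G (u (φ n)))) atTop (𝓝 (fderiv ℝ f x (G x))) :=
    ((isBoundedBilinearMap_apply (𝕜 := ℝ) (E := X) (F := ℝ)).continuous.tendsto
      (fderiv ℝ f x, G x)).comp (((hf'.tendsto x).comp hζ).prodMk_nhds hGφ)
  -- The left side is the squared norm of the gradient at `x`.
  have hle0 : fderiv ℝ f x (G x) ≤ 0 :=
    le_of_tendsto_of_tendsto hlim (by simpa using hsφ.const_mul 2)
      (Eventually.of_forall fun n => hle (φ n))
  have hinner : inner ℝ (G x) (G x) = fderiv ℝ f x (G x) :=
    InnerProductSpace.toDual_symm_apply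
  have hGx : G x = 0 := real_inner_self_nonpos.1 (hinner.trans_le hle0)
  refine ⟨x, ?_, hmc.trans hcx⟩
  have h0 : fderiv ℝ f x = 0 := by simpa [hG] using hGx
  have := (hd x).hasFDerivAt
  rwa [h0] at this

theorem mainTheorem2 {X : Type*} [NormedAddCommGroup X] [InnerProductSpace ℝ X]
    [FiniteDimensional ℝ X] (J μ : X → ℝ)
    (hJ : ContDiff ℝ 1 J) (hJbdd : BddBelow (Set.range J))
    (hμ : ContDiff ℝ 1 μ) (hμnonneg : ∀ x, 0 ≤ μ x) (hμcoer : IsCoerciveFunctional μ)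
    (hμinv : DerivAdmitsContinuousInverse μ)
    (x₀ : X) (r : ℝ) (hr : 0 < r)
    (hB2 : (⨅ x : X, J x) < ⨅ x : {x : X // μ x ≤ r}, J x)
    (hB3 : μ x₀ < r ∧ J x₀ < ⨅ x : {x : X // μ x = r}, J x) :
    ∃ A : Set ℝ, A.Nonempty ∧ IsOpen A ∧ A ⊆ Set.Ioi 0 ∧
      ∀ l ∈ A, 3 ≤ {x : X | IsCritPt (fun y => μ y + l * J y) x}.encard := by
  obtain ⟨y, hy⟩ := exists_lt_of_ciInf_lt hB2
  obtain ⟨hx₀, hB3⟩ := hB3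
  set α := ⨅ x : {x : X // μ x ≤ r}, J x
  set β := ⨅ x : {x : X // μ x = r}, J x
  obtain ⟨B, hB⟩ := hJbdd
  have hB : ∀ x, B ≤ J x := fun x => hB ⟨x, rfl⟩
  have hα : ∀ x, μ x ≤ r → α ≤ J x := fun x hx =>
    ciInf_le (f := fun x : {x : X // μ x ≤ r} => J x)
      ⟨B, by rintro _ ⟨z, rfl⟩; exact hB z⟩ ⟨x, hx⟩
  have hβ : ∀ x, μ x = r → β ≤ J x := fun x hx =>
    ciInf_le (f := fun x : {x : X // μ x = r} => J x)
      ⟨B, by rintro _ ⟨z, rfl⟩; exact hB z⟩ ⟨x, hx⟩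
  have hαy : 0 < α - J y := sub_pos.2 hy
  -- Beyond this threshold `f y < l * α`, while `l * α ≤ f` on `μ ≤ r`; this expels the global
  -- minimizer.
  refine ⟨Set.Ioi (μ y / (α - J y)), Set.nonempty_Ioi, isOpen_Ioi,
    Set.Ioi_subset_Ioi (div_nonneg (hμnonneg y) hαy.le), fun l hl => ?_⟩
  have hl0 : 0 < l := lt_of_le_of_lt (div_nonneg (hμnonneg y) hαy.le) hl
  have hly : μ y < l * (α - J y) := (div_lt_iff₀ hαy).1 hl
  set f : X → ℝ := fun y => μ y + l * J y with hfdef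
  have hf : ContDiff ℝ 1 f := hμ.add (contDiff_const.mul hJ)
  have hd : Differentiable ℝ f := hf.differentiable one_ne_zero
  have hcoer : IsCoerciveFunctional f :=
    hμcoer.add_bddBelow fun x => mul_le_mul_of_nonneg_left (hB x) hl0.le
  have hbarrier : ∀ x, μ x = r → r + l * β ≤ f x := fun x hx => by
    have := mul_le_mul_of_nonneg_left (hβ x hx) hl0.le
    simp only [hfdef, hx]
    linarith
  have hf₀ : f x₀ < r + l * β := add_lt_add hx₀ (mul_lt_mul_of_pos_left hB3 hl0)
  obtain ⟨a, har, hamin⟩ := hcoer.exists_isMinOn hf.continuous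
    (isClosed_le hμ.continuous continuous_const) (s := {x | μ x ≤ r}) ⟨x₀, hx₀.le⟩
  obtain ⟨b, -, hbmin⟩ := hcoer.exists_isMinOn hf.continuous isClosed_univ ⟨x₀, trivial⟩
  have hfa : f a < r + l * β := (hamin (show μ x₀ ≤ r from hx₀.le)).trans_lt hf₀
  have hfb : f b < r + l * β := (hbmin (Set.mem_univ x₀)).trans_lt hf₀
  have har' : μ a < r := lt_of_le_of_ne har fun h => absurd (hbarrier a h) (not_le.2 hfa)
  have hbr : r < μ b := by
    by_contra! h
    have h1 : f b ≤ f y := hbmin (Set.mem_univ y)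
    have h2 := mul_le_mul_of_nonneg_left (hα b h) hl0.le
    have h3 := hμnonneg b
    simp only [hfdef] at h1
    linarith
  have ha : IsCritPt f a := IsLocalMin.isCritPt
    (hamin.isLocalMin (mem_of_superset
      ((isOpen_lt hμ.continuous continuous_const).mem_nhds har')
      fun x (hx : μ x < r) => hx.le)) (hd a)
  have hb : IsCritPt f b := IsLocalMin.isCritPt (hbmin.isLocalMin univ_mem) (hd b)
  obtain ⟨z, hz, hzm⟩ := exists_isCritPt_ge_of_forall_isPreconnected hf hcoer ha hb
    (m := r + l * β) fun C hC haC hbC => by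
      obtain ⟨x, hxC, hx⟩ := hC.intermediate_value haC hbC hμ.continuous.continuousOn
        ⟨har'.le, hbr.le⟩
      exact ⟨x, hxC, hbarrier x hx⟩
  have hab : a ≠ b := fun h => by rw [h] at har'; linarith
  have haz : a ≠ z := fun h => by rw [h] at hfa; linarith
  have hbz : b ≠ z := fun h => by rw [h] at hfb; linarith
  have hcard : ({a, b, z} : Set X).encard = 3 := Set.encard_eq_three.2 ⟨a, b, z, hab, haz, hbz, rfl⟩
  rw [← hcard]
  refine Set.encard_le_encard ?_
  rintro x (rfl | rfl | rfl)
  exacts [ha, hb, hz]
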